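/- Let $G$ be a finite nonabelian $2$-group of coclass two, that is, $|G| = 2^n$ and the nilpotency class of $G$ is $n-2$. Then $G$ is an S-group. Here, for a prime $p$, a finite nonabelian $p$-group $G$ with Frattini subgroup $\Phi(G)$ is called an S-group if \[ \hat{H}^0\bigl(G/\Phi(G);\, Z(\Phi(G))\bigr) \neq 0, \] where $\hat{H}^0$ denotes Tate cohomology in degree $0$ and $G/\Phi(G)$ acts on the center $Z(\Phi(G))$ of $\Phi(G)$ by conjugation. -/

import Mathlib

universe u

open scoped IsMulCommutative

/-- A finite `p`-group of order `p ^ n` and nilpotency class `c` has coclass `n - c`. The equation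
`n = c + r` says that the coclass is `r`. -/
def HasCoclass (p : ℕ) (G : Type u) [Group G] (r : ℕ) : Prop :=
  ∃ n : ℕ, Nat.card G = p ^ n ∧ n = Group.nilpotencyClass G + r

section FrattiniAction

variable (G : Type u) [Group G]

/-- The action of `G` by conjugation on the center `Z(Φ(G))` of its Frattini subgroup. -/
def conjCenterFrattini : G →* MulAut (Subgroup.center (frattini G)) where
  toFun g := Subgroup.centerCongr (MulAut.conjNormal (H := frattini G) g)
  map_one' := by
    ext a
    change ((MulAut.conjNormal (H := frattini G) 1 (a : frattini G) : frattini G) : G) = a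
    simp
  map_mul' g h := by
    ext a
    change ((MulAut.conjNormal (H := frattini G) (g * h) (a : frattini G) : frattini G) : G) =
      (MulAut.conjNormal (H := frattini G) g
        (MulAut.conjNormal (H := frattini G) h (a : frattini G)) : frattini G)
    simp [mul_assoc]

theorem conjCenterFrattini_apply (g : G) (a : Subgroup.center (frattini G)) :
    ((conjCenterFrattini G g a : frattini G) : G) = g * ((a : frattini G) : G) * g⁻¹ :=
  MulAut.conjNormal_apply g (a : frattini G)

theorem frattini_le_ker_conjCenterFrattini :
    frattini G ≤ (conjCenterFrattini G).ker := by
  intro g hg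
  rw [MonoidHom.mem_ker]
  ext a
  have h : g * ((a : frattini G) : G) = ((a : frattini G) : G) * g :=
    congrArg Subtype.val (Subgroup.mem_center_iff.mp a.2 ⟨g, hg⟩)
  rw [conjCenterFrattini_apply, h]
  simp

/-- The action of the Frattini quotient `G / Φ(G)` on `Z(Φ(G))` induced by conjugation:
the class of `g` sends `a` to `g * a * g⁻¹`. -/
def frattiniQuotientAction : G ⧸ frattini G →* MulAut (Subgroup.center (frattini G)) :=
  QuotientGroup.lift (frattini G) (conjCenterFrattini G) (frattini_le_ker_conjCenterFrattini G)

/-- `Z(Φ(G))`, written additively, as an integral representation of `G / Φ(G)`. Mathlib's Tate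
cohomology asks for coefficients in the universe of the group, so the ring of integers appears as
`ULift.{u} ℤ`. -/
def centerFrattiniRepresentation :
    Representation (ULift.{u} ℤ) (G ⧸ frattini G) (Additive (Subgroup.center (frattini G))) where
  toFun q :=
    { toFun := fun a => Additive.ofMul (frattiniQuotientAction G q a.toMul)
      map_add' := fun a b => by simp
      map_smul' := fun m a => by
        change Additive.ofMul (frattiniQuotientAction G q (a.toMul ^ m.down)) =
          Additive.ofMul ((frattiniQuotientAction G q a.toMul) ^ m.down)
        rw [map_zpow] }
  map_one' := by
    ext a
    simp
  map_mul' q r := by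
    ext a
    simp

/-- The Tate cohomology group `Ĥ⁰(G / Φ(G); Z(Φ(G)))`. -/
noncomputable def frattiniTateH0 [Finite G] : ModuleCat (ULift.{u} ℤ) :=
  letI : Fintype (G ⧸ frattini G) := Fintype.ofFinite _
  tateCohomology (Rep.of (centerFrattiniRepresentation G)) 0

/-- A finite group is an S-group if it is a nonabelian `p`-group for some prime `p` and
`Ĥ⁰(G / Φ(G); Z(Φ(G))) ≠ 0`. -/
structure IsSGroup [Finite G] : Prop where
  isPGroup : ∃ p : ℕ, p.Prime ∧ IsPGroup p G
  nonabelian : ∃ a b : G, a * b ≠ b * a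
  tate_ne_zero : Nontrivial (frattiniTateH0 G)

end FrattiniAction

/-!
Write `A = Z(Φ(G))`. Degree zero Tate cohomology of `G / Φ(G)` with coefficients in `A` is the group
of invariants, here `Z(G) ∩ Φ(G)`, modulo norms
(`exists_prod_eq_of_subsingleton_frattiniTateH0`). So it suffices to refute that every element of
`Z(G) ∩ Φ(G)` is a norm.

Let `H` be a maximal subgroup of `G`. The norm over `G / Φ(G)` is the norm over `H / Φ(G)` followed
by the norm over `G / H`. If `Φ(G) / G'` has order at most two, then the norm over `H / Φ(G)` takes
values in the normal subgroup `B(H) = A ∩ C(H) ∩ G'` (`prod_mem_centralizedPart`), since modulo `G'`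
it is a power with even exponent. Suppose moreover that the normal subgroups of `G` contained in
`G'` form a chain. For two different maximal subgroups `H₁`, `H₂` we may then take
`B(H₁) ≤ B(H₂)`, so that `B(H₁)` is centralized by `H₁` and `H₂`, hence by `G`. On central elements
the norm over `G / H₁` is squaring, so every element of `Z(G) ∩ Φ(G)` is a square in this group,
which forces `Z(G) ∩ Φ(G) = 1` and contradicts nilpotency (`IsPGroup.nontrivial_frattiniTateH0`).

It remains to see that a `2`-group of coclass two satisfies the two assumptions.
* If `|G : G'| ≥ 8`, counting shows that `|G : G'| = 8` and that the later factors of the lower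
  central series have order two, whence the normal subgroups inside `G'` are exactly terms of this
  series (`exists_eq_lowerCentralSeries`).
* Otherwise `|G : G'| = 4` and `Φ(G) = G'`. Then `G` has an element `w` with
  `G' = ⟨w²⟩ [G', G]`. By nilpotency `G' ≤ Φ(⟨w⟩ G')`, so `⟨w⟩ G' = ⟨w⟩`
  (`IsPGroup.exists_commutator_le_zpowers`), and the subgroups of a cyclic `2`-group form a chain.
-/

/-! ### Tate cohomology in degree zero and the norm -/

section Tate

open CategoryTheory groupCohomology groupHomology

/-- If `Ĥ⁰(Q; M)` vanishes, then every invariant element of `M` is a norm: the Tate complex is exact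
in degree zero, with the norm as incoming differential and the invariants as kernel of the outgoing
one. -/
theorem exists_norm_eq_of_subsingleton_tateCohomology_zero {R Q : Type u} [CommRing R] [Group Q]
    [Fintype Q] (M : Rep R Q) (h : Subsingleton (tateCohomology M 0)) (x : M)
    (hx : ∀ q, M.ρ q x = x) : ∃ a : M, M.ρ.norm a = x := by
  have h' : Subsingleton ((tateComplex M).homology 0) := h
  have hexact : (tateComplex M).ExactAt 0 :=
    (HomologicalComplex.exactAt_iff_isZero_homology _ _).2 (ModuleCat.isZero_of_subsingleton _)
  rw [HomologicalComplex.exactAt_iff' _ (-1) 0 1 (by simp) (by simp)] at hexact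
  obtain ⟨y, hy⟩ := (ShortComplex.moduleCat_exact_iff _).1 hexact ((cochainsIso₀ M).inv.hom x) (by
    change ((cochainsIso₀ M).inv ≫ (inhomogeneousCochains M).d 0 1).hom x = 0
    rw [eq_d₀₁_comp_inv M]
    have hd : (d₀₁ M).hom x = 0 := by
      rw [← LinearMap.mem_ker, d₀₁_ker_eq_invariants]
      exact hx
    simp only [ModuleCat.hom_comp, LinearMap.comp_apply, hd, map_zero])
  change M.tateNorm.hom y = _ at hy
  refine ⟨(chainsIso₀ M).hom.hom y, ?_⟩
  exact (cochainsIso₀ M).toLinearEquiv.symm.injective hy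

end Tate

section Action

variable {A Q : Type*} [CommGroup A] [Group Q]

/-- The norm over a finite group is transitive through a subgroup of index two. -/
theorem prod_action_eq_of_index_two [Fintype Q] (ρ : Q →* MulAut A) {H : Subgroup Q} [Fintype H]
    (hH : H.index = 2) {t : Q} (ht : t ∉ H) (a : A) :
    ∏ q, ρ q a = (∏ h : H, ρ h a) * ρ t (∏ h : H, ρ h a) := by
  classical
  rw [← Fintype.prod_subtype_mul_prod_subtype (· ∈ H) fun q => ρ q a, map_prod]
  congr 1
  · congr!
  · symm
    have hmem : ∀ q, t * q ∉ H ↔ q ∈ H := fun q => by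
      rw [Subgroup.mul_mem_iff_of_index_two hH]
      tauto
    refine Fintype.prod_equiv ((Equiv.mulLeft t).subtypeEquiv fun q => (hmem q).symm) _ _ ?_
    intro h
    change ρ t (ρ h a) = ρ (t * h) a
    rw [map_mul, MulAut.mul_apply]

theorem action_prod_subgroup (ρ : Q →* MulAut A) {H : Subgroup Q} [Fintype H] {t : Q} (ht : t ∈ H)
    (a : A) : ρ t (∏ h : H, ρ h a) = ∏ h : H, ρ h a := by
  rw [map_prod]
  exact Fintype.prod_equiv (Equiv.mulLeft (⟨t, ht⟩ : H)) _ _ fun h => by simp [MulAut.mul_apply]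

end Action

section Frattini

variable {G : Type u} [Group G]

theorem frattiniQuotientAction_mk (g : G) :
    frattiniQuotientAction G (QuotientGroup.mk' (frattini G) g) = conjCenterFrattini G g :=
  rfl

/-- The multiplicative form of vanishing of `Ĥ⁰(G / Φ(G); Z(Φ(G)))`: every element of `Z(Φ(G))`
fixed by conjugation is a norm. -/
theorem exists_prod_eq_of_subsingleton_frattiniTateH0 [Finite G] [Fintype (G ⧸ frattini G)]
    (h : Subsingleton (frattiniTateH0 G))
    (z : Subgroup.center (frattini G)) (hz : ∀ g, conjCenterFrattini G g z = z) :
    ∃ a, ∏ q, frattiniQuotientAction G q a = z := by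
  obtain rfl := Subsingleton.elim ‹Fintype (G ⧸ frattini G)› (Fintype.ofFinite _)
  let _ : Fintype (G ⧸ frattini G) := Fintype.ofFinite _
  obtain ⟨a, ha⟩ := exists_norm_eq_of_subsingleton_tateCohomology_zero
    (Rep.of (centerFrattiniRepresentation G)) h (Additive.ofMul z) fun q => by
      obtain ⟨g, rfl⟩ := QuotientGroup.mk'_surjective _ q
      exact congrArg Additive.ofMul (hz g)
  refine ⟨Additive.toMul a, ?_⟩
  have ha' : ∑ q, centerFrattiniRepresentation G q a = Additive.ofMul z :=
    (LinearMap.sum_apply _ _ _).symm.trans ha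
  exact (toMul_sum _ _).symm.trans (congrArg Additive.toMul ha')

theorem abelianization_of_frattiniQuotientAction (q : G ⧸ frattini G)
    (a : Subgroup.center (frattini G)) :
    Abelianization.of ((frattiniQuotientAction G q a : frattini G) : G) =
      Abelianization.of ((a : frattini G) : G) := by
  obtain ⟨g, rfl⟩ := QuotientGroup.mk'_surjective _ q
  rw [frattiniQuotientAction_mk, conjCenterFrattini_apply, map_mul, map_mul, map_inv,
    mul_comm (Abelianization.of g), mul_inv_cancel_right]

/-- The subgroup `Z(Φ(G)) ∩ G' ∩ C(H)` of `G`. -/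
def centralizedPart (H : Subgroup G) : Subgroup G :=
  (Subgroup.center (frattini G)).map (frattini G).subtype ⊓ Subgroup.centralizer H ⊓ commutator G

instance centralizedPart_normal (H : Subgroup G) [H.Normal] : (centralizedPart H).Normal := by
  have : (commutator G).Normal := inferInstance
  have : (Subgroup.centralizer (H : Set G)).Normal := inferInstance
  have : ((Subgroup.center (frattini G)).map (frattini G).subtype).Normal := inferInstance
  exact Subgroup.normal_inf_normal _ _

/-- The norm over `H / Φ(G)` lands in the part of `G'` centralized by `H`: modulo `G'` it is
a power with even exponent of an element of `Φ(G)`. -/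
theorem prod_mem_centralizedPart (hsq : ∀ x ∈ frattini G, x ^ 2 ∈ commutator G) {H : Subgroup G}
    [Fintype (H.map (QuotientGroup.mk' (frattini G)))]
    (heven : Even (Nat.card (H.map (QuotientGroup.mk' (frattini G)))))
    (a : Subgroup.center (frattini G)) :
    (((∏ h : H.map (QuotientGroup.mk' (frattini G)), frattiniQuotientAction G h a :
      Subgroup.center (frattini G)) : frattini G) : G) ∈ centralizedPart H := by
  refine ⟨⟨⟨_, SetLike.coe_mem _, rfl⟩, ?_⟩, ?_⟩
  · intro g hg
    have hfix := action_prod_subgroup (frattiniQuotientAction G)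
      (Subgroup.mem_map_of_mem (QuotientGroup.mk' (frattini G)) hg) a
    rw [frattiniQuotientAction_mk] at hfix
    have hfix' := congrArg (fun b : Subgroup.center (frattini G) => ((b : frattini G) : G)) hfix
    simp only [conjCenterFrattini_apply] at hfix'
    exact mul_inv_eq_iff_eq_mul.1 hfix'
  · obtain ⟨k, hk⟩ := heven
    let φ : Subgroup.center (frattini G) →* Abelianization G :=
      Abelianization.of.comp ((frattini G).subtype.comp (Subgroup.center (frattini G)).subtype)
    have hφ : ∀ q, φ (frattiniQuotientAction G q a) = φ a := fun q =>
      abelianization_of_frattiniQuotientAction q a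
    have h2 : φ a ^ 2 = 1 := by
      rw [← map_pow, ← MonoidHom.mem_ker]
      change Abelianization.of (((a ^ 2 : Subgroup.center (frattini G)) : frattini G) : G) = 1
      rw [← MonoidHom.mem_ker, Abelianization.ker_of]
      exact hsq _ (SetLike.coe_mem _)
    change _ ∈ commutator G
    rw [← Abelianization.ker_of, MonoidHom.mem_ker]
    change φ _ = 1
    rw [map_prod]
    simp only [hφ]
    rw [Finset.prod_const, Finset.card_univ,
      ← Nat.card_eq_fintype_card, hk, ← two_mul, pow_mul, h2, one_pow]

/-- If `H₁` and `H₂` are distinct subgroups of index two whose centralized parts are comparable,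
then the smaller centralized part is central in `G`. -/
theorem centralizedPart_le_center {H₁ H₂ : Subgroup G} (hsup : H₁ ⊔ H₂ = ⊤)
    (hle : centralizedPart H₁ ≤ centralizedPart H₂) :
    centralizedPart H₁ ≤ Subgroup.center G := by
  intro b hb
  have h₁ : H₁ ≤ Subgroup.centralizer {b} := fun g hg =>
    Subgroup.mem_centralizer_singleton_iff.2 (hb.1.2 g hg)
  have h₂ : H₂ ≤ Subgroup.centralizer {b} := fun g hg =>
    Subgroup.mem_centralizer_singleton_iff.2 ((hle hb).1.2 g hg)
  have htop : (⊤ : Subgroup G) ≤ Subgroup.centralizer {b} := hsup ▸ sup_le h₁ h₂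
  exact Subgroup.mem_center_iff.2 fun g =>
    Subgroup.mem_centralizer_singleton_iff.1 (htop (Subgroup.mem_top g))

/-- If all norms from `Z(Φ(G))` over `H / Φ(G)` are central in `G`, then the norm over `G / Φ(G)`
is the square of such a norm. -/
theorem exists_sq_eq_of_centralizedPart_le_center [Finite G] (h : Subsingleton (frattiniTateH0 G))
    (hsq : ∀ x ∈ frattini G, x ^ 2 ∈ commutator G) (h4 : 4 ∣ (frattini G).index)
    {H : Subgroup G} (hH : H.index = 2) (hΦ : frattini G ≤ H)
    (hcen : centralizedPart H ≤ Subgroup.center G) {z : G}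
    (hz : z ∈ Subgroup.center G ⊓ frattini G) :
    ∃ b ∈ Subgroup.center G ⊓ frattini G, b ^ 2 = z := by
  classical
  let _ : Fintype (G ⧸ frattini G) := Fintype.ofFinite _
  set K := H.map (QuotientGroup.mk' (frattini G)) with hK
  let _ : Fintype K := Fintype.ofFinite _
  have hKindex : K.index = 2 := by
    rw [hK, Subgroup.index_map_eq _ (QuotientGroup.mk'_surjective _) (by simpa using hΦ), hH]
  have heven : Even (Nat.card K) := by
    have := K.card_mul_index
    rw [hKindex, ← Subgroup.index_eq_card] at this
    rw [even_iff_two_dvd]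
    omega
  let z' : Subgroup.center (frattini G) := ⟨⟨z, hz.2⟩, Subgroup.mem_center_iff.2 fun x =>
    Subtype.ext (Subgroup.mem_center_iff.1 hz.1 x)⟩
  obtain ⟨a, ha⟩ := exists_prod_eq_of_subsingleton_frattiniTateH0 h z' fun g => by
    apply Subtype.ext
    apply Subtype.ext
    rw [conjCenterFrattini_apply]
    exact mul_inv_eq_of_eq_mul (Subgroup.mem_center_iff.1 hz.1 g)
  set b := ∏ h : K, frattiniQuotientAction G h a with hb
  have hbK : ((b : frattini G) : G) ∈ Subgroup.center G :=
    hcen (prod_mem_centralizedPart hsq heven a)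
  refine ⟨((b : frattini G) : G), ⟨hbK, SetLike.coe_mem _⟩, ?_⟩
  obtain ⟨t, ht⟩ : ∃ t, t ∉ K := by
    by_contra! hall
    rw [(Subgroup.eq_top_iff' K).2 hall, Subgroup.index_top] at hKindex
    omega
  rw [prod_action_eq_of_index_two _ hKindex ht a, ← hb] at ha
  obtain ⟨g, rfl⟩ := QuotientGroup.mk'_surjective _ t
  have hfix : conjCenterFrattini G g b = b := by
    apply Subtype.ext
    apply Subtype.ext
    rw [conjCenterFrattini_apply]
    exact mul_inv_eq_of_eq_mul (Subgroup.mem_center_iff.1 hbK g)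
  rw [frattiniQuotientAction_mk, hfix, ← sq] at ha
  exact congrArg (fun b : Subgroup.center (frattini G) => ((b : frattini G) : G)) ha

end Frattini

/-! ### Finite `2`-groups: maximal subgroups and the Frattini subgroup -/

section TwoGroup

variable {G : Type*} [Group G] [Finite G]

theorem two_mul_card_le_of_lt {H K : Subgroup G} (h : H < K) : 2 * Nat.card H ≤ Nat.card K := by
  obtain ⟨k, hk⟩ := Subgroup.card_dvd_of_le h.le
  have hne : Nat.card H ≠ Nat.card K := fun e => h.ne (Subgroup.eq_of_le_of_card_ge h.le e.ge)
  have hK : 0 < Nat.card K := Nat.card_pos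
  rcases k with _ | _ | k
  · omega
  · omega
  · rw [hk, mul_comm]
    exact Nat.mul_le_mul_left _ (by omega)

theorem IsPGroup.index_eq_two_of_isCoatom (hG : IsPGroup 2 G) {H : Subgroup G} (hH : IsCoatom H) :
    H.index = 2 := by
  have := Fact.mk Nat.prime_two
  obtain ⟨n, hn⟩ := IsPGroup.iff_card.1 hG
  obtain ⟨m, hm⟩ := IsPGroup.iff_card.1 (hG.to_subgroup H)
  have hlt : m < n := by
    have := two_mul_card_le_of_lt hH.lt_top
    rw [hm, Subgroup.card_top, hn, ← pow_succ'] at this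
    exact (Nat.pow_le_pow_iff_right one_lt_two).1 this
  obtain ⟨K, hK, hHK⟩ := Sylow.exists_subgroup_card_pow_prime_le 2 (m := n - 1)
    (hn ▸ pow_dvd_pow 2 (n.sub_le 1)) H hm (by omega)
  have hindex := K.card_mul_index
  obtain ⟨l, rfl⟩ : ∃ l, n = l + 1 := ⟨n - 1, by omega⟩
  rw [hn, hK, Nat.add_sub_cancel, pow_succ] at hindex
  have hK2 : K.index = 2 := Nat.eq_of_mul_eq_mul_left (by positivity) hindex
  rcases hH.le_iff.1 hHK with rfl | rfl
  · simp at hK2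
  · exact hK2

theorem IsPGroup.normal_of_isCoatom (hG : IsPGroup 2 G) {H : Subgroup G} (hH : IsCoatom H) :
    H.Normal :=
  Subgroup.normal_of_index_eq_two (hG.index_eq_two_of_isCoatom hH)

omit [Finite G] in
theorem le_frattini {H : Subgroup G} (h : ∀ M : Subgroup G, IsCoatom M → H ≤ M) :
    H ≤ frattini G :=
  le_iInf₂ h

theorem IsPGroup.sq_mem_frattini (hG : IsPGroup 2 G) (x : G) : x ^ 2 ∈ frattini G := by
  have h : Subgroup.zpowers (x ^ 2) ≤ frattini G := le_frattini fun M hM => by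
    rw [Subgroup.zpowers_le]
    exact Subgroup.sq_mem_of_index_two (hG.index_eq_two_of_isCoatom hM) x
  exact h (Subgroup.mem_zpowers _)

theorem IsPGroup.commutator_le_frattini (hG : IsPGroup 2 G) : commutator G ≤ frattini G := by
  refine le_frattini fun M hM => ?_
  have hM2 := hG.index_eq_two_of_isCoatom hM
  have := hG.normal_of_isCoatom hM
  refine Subgroup.Normal.quotient_commutative_iff_commutator_le.1 ?_
  have : Fact (Nat.card (G ⧸ M)).Prime :=
    ⟨by rw [← Subgroup.index_eq_card, hM2]; exact Nat.prime_two⟩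
  have : IsCyclic (G ⧸ M) := isCyclic_of_prime_card (p := Nat.card (G ⧸ M)) rfl
  infer_instance

omit [Finite G] in
theorem zpowers_ne_top (hG : ∃ a b : G, a * b ≠ b * a) (x : G) : Subgroup.zpowers x ≠ ⊤ := by
  intro h
  obtain ⟨a, b, hab⟩ := hG
  obtain ⟨i, rfl⟩ := Subgroup.mem_zpowers_iff.1 (h ▸ Subgroup.mem_top a : a ∈ Subgroup.zpowers x)
  obtain ⟨j, rfl⟩ := Subgroup.mem_zpowers_iff.1 (h ▸ Subgroup.mem_top b : b ∈ Subgroup.zpowers x)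
  exact hab (zpow_mul_comm x i j)

theorem exists_isCoatom_mem (hG : ∃ a b : G, a * b ≠ b * a) (x : G) :
    ∃ H : Subgroup G, IsCoatom H ∧ x ∈ H := by
  obtain h | ⟨H, hH, hle⟩ := eq_top_or_exists_le_coatom (Subgroup.zpowers x)
  · exact absurd h (zpowers_ne_top hG x)
  · exact ⟨H, hH, hle (Subgroup.mem_zpowers x)⟩

omit [Finite G] in
theorem exists_notMem_of_isCoatom {H : Subgroup G} (hH : IsCoatom H) : ∃ x, x ∉ H := by
  by_contra! h
  exact hH.1 ((Subgroup.eq_top_iff' H).2 h)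

theorem exists_isCoatom_ne (hG : ∃ a b : G, a * b ≠ b * a) :
    ∃ H₁ H₂ : Subgroup G, IsCoatom H₁ ∧ IsCoatom H₂ ∧ H₁ ≠ H₂ := by
  obtain ⟨H₁, hH₁, -⟩ := exists_isCoatom_mem hG 1
  obtain ⟨x, hx⟩ := exists_notMem_of_isCoatom hH₁
  obtain ⟨H₂, hH₂, hx₂⟩ := exists_isCoatom_mem hG x
  exact ⟨H₁, H₂, hH₁, hH₂, fun h => hx (h ▸ hx₂)⟩

/-- A subgroup of a `2`-group contained in two different maximal subgroups has index divisible by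
four. -/
theorem IsPGroup.four_dvd_index_of_le (hG : IsPGroup 2 G) {K H₁ H₂ : Subgroup G} (hH₁ : IsCoatom H₁)
    (hH₂ : IsCoatom H₂) (hne : H₁ ≠ H₂) (h₁ : K ≤ H₁) (h₂ : K ≤ H₂) : 4 ∣ K.index := by
  have := Fact.mk Nat.prime_two
  obtain ⟨k, hk⟩ := IsPGroup.iff_card.1 hG
  obtain ⟨n, -, hn⟩ := (Nat.dvd_prime_pow Nat.prime_two).1 (hk ▸ K.index_dvd_card)
  have hlt : K < H₁ := h₁.lt_of_ne fun h => by
    subst h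
    exact hne ((hH₁.le_iff.1 h₂).resolve_left hH₂.1).symm
  have h4 : 4 ≤ K.index := by
    rw [← Subgroup.relIndex_mul_index h₁, hG.index_eq_two_of_isCoatom hH₁]
    have h1 : K.relIndex H₁ ≠ 1 := fun h => hlt.not_ge (Subgroup.relIndex_eq_one.1 h)
    have h0 : K.relIndex H₁ ≠ 0 := (K.subgroupOf H₁).index_ne_zero_of_finite
    omega
  rw [hn] at h4 ⊢
  have h2 : 2 ^ 2 ≤ 2 ^ n := h4
  exact pow_dvd_pow 2 (m := 2) ((Nat.pow_le_pow_iff_right one_lt_two).1 h2)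

theorem IsPGroup.four_dvd_index_frattini (hG : IsPGroup 2 G) (hna : ∃ a b : G, a * b ≠ b * a) :
    4 ∣ (frattini G).index := by
  obtain ⟨H₁, H₂, hH₁, hH₂, hne⟩ := exists_isCoatom_ne hna
  exact hG.four_dvd_index_of_le hH₁ hH₂ hne (frattini_le_coatom hH₁) (frattini_le_coatom hH₂)

omit [Finite G] in
theorem commutator_ne_bot (hna : ∃ a b : G, a * b ≠ b * a) : commutator G ≠ ⊥ := by
  intro h
  obtain ⟨a, b, hab⟩ := hna
  have hmem := Subgroup.commutator_mem_commutator (Subgroup.mem_top a) (Subgroup.mem_top b)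
  rw [← commutator_def, h, Subgroup.mem_bot] at hmem
  exact hab (commutatorElement_eq_one_iff_mul_comm.1 hmem)

/-- If `G'` has index at most eight in a nonabelian `2`-group `G`, then `Φ(G) / G'` has order at
most two, because `G / Φ(G)` has order at least four. -/
theorem IsPGroup.sq_mem_commutator_of_mem_frattini (hG : IsPGroup 2 G)
    (hna : ∃ a b : G, a * b ≠ b * a) (h8 : (commutator G).index ∣ 8) {x : G}
    (hx : x ∈ frattini G) : x ^ 2 ∈ commutator G := by
  obtain ⟨k, hk⟩ := hG.four_dvd_index_frattini hna
  have h := Subgroup.relIndex_mul_index hG.commutator_le_frattini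
  have hdvd : (commutator G).relIndex (frattini G) ∣ 2 := by
    rw [← h, hk] at h8
    refine Nat.dvd_of_mul_dvd_mul_right (k := 4) (by norm_num) ?_
    exact (Dvd.intro k (by ring)).trans h8
  have hpow := Subgroup.pow_index_mem ((commutator G).subgroupOf (frattini G)) ⟨x, hx⟩
  obtain ⟨j, hj⟩ := hdvd
  have hpow2 := Subgroup.pow_mem _ hpow j
  rw [← pow_mul] at hpow2
  change _ ^ ((commutator G).relIndex (frattini G) * j) ∈ _ at hpow2
  rw [← hj] at hpow2
  exact Subgroup.mem_subgroupOf.1 hpow2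

end TwoGroup

/-! ### The lower central series -/

section LowerCentral

variable {G : Type*} [Group G]

open Subgroup

theorem lowerCentralSeries_eq_bot_of_le_succ [Group.IsNilpotent G] {i : ℕ}
    (h : (⊤ : Subgroup G).lowerCentralSeries i ≤ (⊤ : Subgroup G).lowerCentralSeries (i + 1)) :
    (⊤ : Subgroup G).lowerCentralSeries i = ⊥ := by
  have key : ∀ k, (⊤ : Subgroup G).lowerCentralSeries (i + k) ≤
      (⊤ : Subgroup G).lowerCentralSeries (i + k + 1) := fun k => by
    induction k with
    | zero => exact h
    | succ k ih => exact commutator_mono ih le_rfl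
  have key' : ∀ k, (⊤ : Subgroup G).lowerCentralSeries i ≤
      (⊤ : Subgroup G).lowerCentralSeries (i + k) := fun k => by
    induction k with
    | zero => exact le_rfl
    | succ k ih => exact ih.trans (key k)
  obtain ⟨n, hn⟩ := Subgroup.nilpotent_iff_lowerCentralSeries.1 ‹Group.IsNilpotent G›
  exact eq_bot_iff.2 ((key' n).trans (((⊤ : Subgroup G).lowerCentralSeries_antitone
    (Nat.le_add_left n i)).trans hn.le))

/-- If a normal subgroup `N` of a nilpotent group and the next term of the lower central series
together generate a term, then `N` contains this term: modulo `N` the two terms agree, so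
they vanish. -/
theorem lowerCentralSeries_le_of_le_sup_succ [Group.IsNilpotent G] {N : Subgroup G} [N.Normal]
    {i : ℕ}
    (h : (⊤ : Subgroup G).lowerCentralSeries i ≤ N ⊔ (⊤ : Subgroup G).lowerCentralSeries (i + 1)) :
    (⊤ : Subgroup G).lowerCentralSeries i ≤ N := by
  have hmap : ∀ j, ((⊤ : Subgroup G).lowerCentralSeries j).map (QuotientGroup.mk' N) =
      (⊤ : Subgroup (G ⧸ N)).lowerCentralSeries j := fun j => by
    rw [map_lowerCentralSeries, map_top_of_surjective _ (QuotientGroup.mk'_surjective N)]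
  have h' := map_mono (f := QuotientGroup.mk' N) h
  rw [Subgroup.map_sup, hmap, hmap, QuotientGroup.map_mk'_self, bot_sup_eq] at h'
  have h0 := lowerCentralSeries_eq_bot_of_le_succ h'
  rw [← hmap, Subgroup.map_eq_bot_iff, QuotientGroup.ker_mk'] at h0
  exact h0

end LowerCentral

section Uniserial

variable {G : Type*} [Group G] [Finite G]

open Subgroup

/-- If `|G| = 2 ^ (c + 2)` with `c` the nilpotency class and `|G : G'| ≥ 8`, then all factors of
the lower central series below `G / G'` have order two. -/
theorem card_lowerCentralSeries [Group.IsNilpotent G]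
    (hcard : Nat.card G = 2 ^ (Group.nilpotencyClass G + 2)) (h8 : 8 ≤ (commutator G).index) {i : ℕ}
    (hi : 1 ≤ i) (hic : i ≤ Group.nilpotencyClass G) :
    Nat.card ((⊤ : Subgroup G).lowerCentralSeries i) = 2 ^ (Group.nilpotencyClass G - i) := by
  set c := Group.nilpotencyClass G
  -- Before reaching the trivial subgroup the orders at least halve at every step, and
  -- `|G'| ≤ 2 ^ (c - 1)` leaves no room for a bigger drop.
  have hstep : ∀ j < c, 2 * Nat.card ((⊤ : Subgroup G).lowerCentralSeries (j + 1)) ≤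
      Nat.card ((⊤ : Subgroup G).lowerCentralSeries j) := fun j hj => by
    refine two_mul_card_le_of_lt (((⊤ : Subgroup G).lowerCentralSeries_antitone
      j.le_succ).lt_of_not_ge fun hle => ?_)
    have := Subgroup.lowerCentralSeries_eq_bot_iff_nilpotencyClass_le.1
      (lowerCentralSeries_eq_bot_of_le_succ hle)
    omega
  have hlow : ∀ k j, j + k = c → 2 ^ k ≤ Nat.card ((⊤ : Subgroup G).lowerCentralSeries j) := by
    intro k
    induction k with
    | zero => exact fun j _ => Nat.card_pos
    | succ k ih =>
      intro j hj
      have h1 := ih (j + 1) (by omega)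
      have h2 := hstep j (by omega)
      rw [pow_succ]
      omega
  have hup : ∀ k, 1 + k ≤ c → Nat.card ((⊤ : Subgroup G).lowerCentralSeries (1 + k)) * 2 ^ k ≤
      Nat.card ((⊤ : Subgroup G).lowerCentralSeries 1) := by
    intro k
    induction k with
    | zero => simp
    | succ k ih =>
      intro hk
      have h1 := ih (by omega)
      have h2 := hstep (1 + k) (by omega)
      refine le_trans ?_ h1
      rw [pow_succ, ← mul_assoc, mul_right_comm]
      exact Nat.mul_le_mul_right _ (by rw [mul_comm]; exact h2)
  have hone : Nat.card ((⊤ : Subgroup G).lowerCentralSeries 1) ≤ 2 ^ (c - 1) := by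
    rw [top_lowerCentralSeries_one]
    have := (commutator G).card_mul_index
    obtain ⟨d, hd⟩ : ∃ d, c = d + 1 := ⟨c - 1, by omega⟩
    rw [hcard, hd] at this
    have h := Nat.mul_le_mul_left (Nat.card (commutator G)) h8
    rw [this, show 2 ^ (d + 1 + 2) = 2 ^ d * 8 by ring] at h
    rw [hd, Nat.add_sub_cancel]
    omega
  refine le_antisymm ?_ (hlow _ i (by omega))
  obtain ⟨k, rfl⟩ : ∃ k, i = 1 + k := ⟨i - 1, by omega⟩
  have h := (hup k hic).trans hone
  rw [show c - 1 = (c - (1 + k)) + k by omega, pow_add] at h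
  exact Nat.le_of_mul_le_mul_right h (by positivity)

/-- Under the assumptions of `card_lowerCentralSeries`, every normal subgroup inside `G'` is a term
of the lower central series. -/
theorem exists_eq_lowerCentralSeries [Group.IsNilpotent G]
    (hcard : Nat.card G = 2 ^ (Group.nilpotencyClass G + 2)) (h8 : 8 ≤ (commutator G).index)
    {N : Subgroup G} [N.Normal] (hN : N ≤ commutator G) :
    ∃ i, N = (⊤ : Subgroup G).lowerCentralSeries i := by
  by_contra! hne
  have hle : ∀ k, N ≤ (⊤ : Subgroup G).lowerCentralSeries (1 + k) := by
    intro k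
    induction k with
    | zero => rwa [add_zero, top_lowerCentralSeries_one]
    | succ k ih =>
      by_contra hnot
      -- If `N` lies in one term but not in the next, then together with the next term, which has
      -- index two, it generates the term, hence `N` is the whole term by nilpotency.
      have hlt : (⊤ : Subgroup G).lowerCentralSeries (1 + k + 1) <
          N ⊔ (⊤ : Subgroup G).lowerCentralSeries (1 + k + 1) :=
        le_sup_right.lt_of_ne fun h => hnot (left_eq_sup.1 (by rw [sup_comm]; exact h))
      have hsup : N ⊔ (⊤ : Subgroup G).lowerCentralSeries (1 + k + 1) ≤
          (⊤ : Subgroup G).lowerCentralSeries (1 + k) :=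
        sup_le ih ((⊤ : Subgroup G).lowerCentralSeries_antitone (Nat.le_succ _))
      have hkc : 1 + k < Group.nilpotencyClass G := by
        by_contra! hge
        have hbot := Subgroup.lowerCentralSeries_eq_bot_iff_nilpotencyClass_le.2 hge
        rw [hbot, le_bot_iff] at ih
        exact hne (1 + k) (ih.trans hbot.symm)
      have h1 := card_lowerCentralSeries hcard h8 (i := 1 + k) (by omega) hkc.le
      have h2 := card_lowerCentralSeries hcard h8 (i := 1 + k + 1) (by omega) hkc
      have h3 := two_mul_card_le_of_lt hlt
      rw [h2, ← pow_succ', show Group.nilpotencyClass G - (1 + k + 1) + 1 =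
        Group.nilpotencyClass G - (1 + k) by omega, ← h1] at h3
      have heq := Subgroup.eq_of_le_of_card_ge hsup h3
      exact hne (1 + k) (le_antisymm ih (lowerCentralSeries_le_of_le_sup_succ heq.ge))
  refine hne (1 + Group.nilpotencyClass G) ?_
  have hbot := Subgroup.lowerCentralSeries_eq_bot_iff_nilpotencyClass_le.2
    (Nat.le_add_left (Group.nilpotencyClass G) 1)
  rw [hbot]
  exact le_bot_iff.1 (hbot ▸ hle _)

theorem index_commutator_eq_eight [Group.IsNilpotent G]
    (hcard : Nat.card G = 2 ^ (Group.nilpotencyClass G + 2)) (h8 : 8 ≤ (commutator G).index)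
    (hne : commutator G ≠ ⊥) : (commutator G).index = 8 := by
  have hc : 1 ≤ Group.nilpotencyClass G := by
    by_contra! hlt
    refine hne ?_
    rw [← top_lowerCentralSeries_one, Subgroup.lowerCentralSeries_eq_bot_iff_nilpotencyClass_le]
    omega
  have h := (commutator G).card_mul_index
  have h1 := card_lowerCentralSeries hcard h8 le_rfl hc
  rw [top_lowerCentralSeries_one] at h1
  obtain ⟨d, hd⟩ : ∃ d, Group.nilpotencyClass G = d + 1 := ⟨Group.nilpotencyClass G - 1, by omega⟩
  rw [h1, hcard, hd, Nat.add_sub_cancel, show 2 ^ (d + 1 + 2) = 2 ^ d * 8 by ring] at h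
  exact Nat.eq_of_mul_eq_mul_left (by positivity) h

end Uniserial

/-! ### `2`-groups with abelianization of order four -/

section Taussky

open Subgroup
open scoped commutatorElement

/-- If `x` and `y` generate a group and `⁅x, y⁆` is central, then the derived subgroup is generated
by `⁅x, y⁆`: modulo this element the generators commute. -/
theorem commutator_le_zpowers_of_closure_pair {K : Type*} [Group K] {x y : K}
    (hcl : closure {x, y} = ⊤) (hc : ⁅x, y⁆ ∈ center K) : _root_.commutator K ≤ zpowers ⁅x, y⁆ := by
  have hle : zpowers ⁅x, y⁆ ≤ center K := zpowers_le.2 hc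
  have hnormal : (zpowers ⁅x, y⁆).Normal := ⟨fun n hn g => by
    rwa [mem_center_iff.1 (hle hn) g, mul_inv_cancel_right]⟩
  refine Subgroup.Normal.quotient_commutative_iff_commutator_le.1 ?_
  set π := QuotientGroup.mk' (zpowers ⁅x, y⁆) with hπ
  have hcl' : closure {π x, π y} = ⊤ := by
    rw [← Set.image_pair, ← MonoidHom.map_closure, hcl,
      map_top_of_surjective _ (QuotientGroup.mk'_surjective _)]
  have hxy : π x * π y = π y * π x := by
    rw [← commutatorElement_eq_one_iff_mul_comm, ← map_commutatorElement, ← MonoidHom.mem_ker, hπ,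
      QuotientGroup.ker_mk']
    exact mem_zpowers _
  have hgen : ∀ a, a * π x = π x * a → a * π y = π y * a → a ∈ center (K ⧸ zpowers ⁅x, y⁆) := by
    intro a hx hy
    have h : closure {π x, π y} ≤ centralizer {a} := by
      rw [closure_le]
      rintro _ (rfl | rfl)
      · exact mem_centralizer_singleton_iff.2 hx.symm
      · exact mem_centralizer_singleton_iff.2 hy.symm
    rw [hcl'] at h
    exact mem_center_iff.2 fun g => mem_centralizer_singleton_iff.1 (h (mem_top g))
  have hcenter : closure {π x, π y} ≤ center (K ⧸ zpowers ⁅x, y⁆) := by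
    rw [closure_le]
    rintro _ (rfl | rfl)
    · exact hgen _ rfl hxy
    · exact hgen _ hxy.symm rfl
  rw [hcl'] at hcenter
  exact ⟨⟨fun a b => mem_center_iff.1 (hcenter (mem_top b)) a⟩⟩

/-- In a two-generator group of class at most two with elementary abelian abelianization, the
derived subgroup has order at most two. If it is nontrivial, some square is nontrivial
and generates it. -/
theorem exists_commutator_le_zpowers_sq {K : Type*} [Group K] {x y : K}
    (hcl : closure {x, y} = ⊤) (hsq : ∀ g : K, g ^ 2 ∈ _root_.commutator K)
    (hcen : _root_.commutator K ≤ center K) : ∃ w : K, _root_.commutator K ≤ zpowers (w ^ 2) := by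
  have hc : ⁅x, y⁆ ∈ center K :=
    hcen (commutator_mem_commutator (mem_top x) (mem_top y))
  have hle := commutator_le_zpowers_of_closure_pair hcl hc
  have hc2 : ⁅x, y⁆ ^ 2 = 1 := by
    have h1 : x * y = ⁅x, y⁆ * (y * x) := by simp [commutatorElement_def, mul_assoc]
    have h2 := mem_center_iff.1 (hcen (hsq x)) y
    have h3 := mem_center_iff.1 hc x
    -- Moving `y` to the left past `x` twice produces `⁅x, y⁆ ^ 2`, but `x ^ 2` is central.
    have h4 : x ^ 2 * y = ⁅x, y⁆ ^ 2 * (y * x ^ 2) := by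
      calc x ^ 2 * y = x * (x * y) := by rw [sq, mul_assoc]
        _ = x * (⁅x, y⁆ * (y * x)) := by rw [← h1]
        _ = ⁅x, y⁆ * (x * y) * x := by rw [← mul_assoc, h3]; simp only [mul_assoc]
        _ = ⁅x, y⁆ * (⁅x, y⁆ * (y * x)) * x := by rw [← h1]
        _ = _ := by simp only [sq, mul_assoc]
    rw [h2] at h4
    exact mul_eq_right.1 h4.symm
  by_cases h : ∃ w : K, w ^ 2 ≠ 1
  · obtain ⟨w, hw⟩ := h
    refine ⟨w, hle.trans (zpowers_le.2 ?_)⟩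
    obtain ⟨i, hi⟩ := mem_zpowers_iff.1 (hle (hsq w))
    rcases Int.even_or_odd' i with ⟨k, rfl | rfl⟩
    · refine absurd ?_ hw
      rw [← hi, zpow_mul, zpow_ofNat, hc2, one_zpow]
    · rw [zpow_add, zpow_mul, zpow_ofNat, hc2, one_zpow, one_mul, zpow_one] at hi
      rw [hi]
      exact mem_zpowers _
  · push Not at h
    refine ⟨1, ?_⟩
    have hcomm : ∀ a b : K, a * b = b * a := fun a b => by
      have h1 : ∀ g : K, g⁻¹ = g := fun g => inv_eq_of_mul_eq_one_left (by rw [← sq, h])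
      rw [← h1 (a * b), mul_inv_rev, h1, h1]
    rw [_root_.commutator_def, commutator_le]
    intro a _ b _
    rw [commutatorElement_eq_one_iff_mul_comm.2 (hcomm a b)]
    exact one_mem _

variable {G : Type*} [Group G] [Finite G]

theorem IsPGroup.exists_closure_pair_eq_top (hG : IsPGroup 2 G) (hna : ∃ a b : G, a * b ≠ b * a)
    (h4 : (frattini G).index = 4) : ∃ x y : G, closure {x, y} = ⊤ := by
  obtain ⟨H₁, hH₁, -⟩ := exists_isCoatom_mem hna 1
  obtain ⟨x, hx⟩ := exists_notMem_of_isCoatom hH₁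
  obtain ⟨H₂, hH₂, hx₂⟩ := exists_isCoatom_mem hna x
  obtain ⟨y, hy⟩ := exists_notMem_of_isCoatom hH₂
  refine ⟨x, y, (eq_top_or_exists_le_coatom _).resolve_right ?_⟩
  rintro ⟨H₃, hH₃, hle⟩
  -- Both `H₂` and `H₃` contain `x`, and `H₂ ⊓ H₃ = Φ(G)` by comparing indices; but `x ∉ Φ(G)`.
  have hx₃ : x ∈ H₃ := hle (subset_closure (by simp))
  have hne : H₂ ≠ H₃ := fun h => hy (h ▸ hle (subset_closure (by simp)))
  have hΦ : frattini G ≤ H₂ ⊓ H₃ := le_inf (frattini_le_coatom hH₂) (frattini_le_coatom hH₃)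
  have hdvd := hG.four_dvd_index_of_le hH₂ hH₃ hne inf_le_left inf_le_right
  have hrel := relIndex_mul_index hΦ
  rw [h4] at hrel
  have hindex : (H₂ ⊓ H₃).index = 4 := Nat.dvd_antisymm (hrel ▸ Nat.dvd_mul_left _ _) hdvd
  rw [hindex] at hrel
  have hle' : H₂ ⊓ H₃ ≤ frattini G := relIndex_eq_one.1 (by omega)
  exact hx (frattini_le_coatom hH₁ (hle' ⟨hx₂, hx₃⟩))

/-- The derived subgroup of a nonabelian `2`-group with abelianization of order four is cyclic: it
lies in a cyclic maximal subgroup. -/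
theorem IsPGroup.exists_commutator_le_zpowers (hG : IsPGroup 2 G)
    (hna : ∃ a b : G, a * b ≠ b * a) (h4 : (frattini G).index = 4)
    (hΦ : frattini G = _root_.commutator G) : ∃ w : G, _root_.commutator G ≤ zpowers w := by
  have := Fact.mk Nat.prime_two
  have := hG.isNilpotent
  obtain ⟨x, y, hcl⟩ := hG.exists_closure_pair_eq_top hna h4
  set π := QuotientGroup.mk' ((⊤ : Subgroup G).lowerCentralSeries 2) with hπ
  have hsurj : Function.Surjective π := QuotientGroup.mk'_surjective _
  have hmap : ∀ j, ((⊤ : Subgroup G).lowerCentralSeries j).map π =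
      (⊤ : Subgroup (G ⧸ (⊤ : Subgroup G).lowerCentralSeries 2)).lowerCentralSeries j := fun j => by
    rw [map_lowerCentralSeries, map_top_of_surjective _ hsurj]
  -- In the quotient by the third term of the lower central series, a square generates the derived
  -- subgroup.
  obtain ⟨w', hw'⟩ := exists_commutator_le_zpowers_sq (x := π x) (y := π y)
    (by rw [← Set.image_pair, ← MonoidHom.map_closure, hcl, map_top_of_surjective _ hsurj])
    (fun g => by
      obtain ⟨g, rfl⟩ := hsurj g
      rw [← top_lowerCentralSeries_one, ← hmap, top_lowerCentralSeries_one, ← map_pow]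
      exact mem_map_of_mem _ (hΦ ▸ hG.sq_mem_frattini g))
    (by
      rw [← commutator_top_right_eq_bot_iff_le_center, ← top_lowerCentralSeries_one,
        ← Subgroup.lowerCentralSeries_succ, ← hmap]
      exact QuotientGroup.map_mk'_self _)
  obtain ⟨w, rfl⟩ := hsurj w'
  have hw : (⊤ : Subgroup G).lowerCentralSeries 1 ≤
      zpowers (w ^ 2) ⊔ (⊤ : Subgroup G).lowerCentralSeries 2 := by
    have h := map_le_iff_le_comap.1
      (((hmap 1).trans (top_lowerCentralSeries_one)).le.trans hw')
    rwa [← map_pow, ← MonoidHom.map_zpowers, comap_map_eq, QuotientGroup.ker_mk'] at h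
  -- Since `w ^ 2 ∈ Φ(M)`, nilpotency gives `G' ≤ Φ(M)`, so `w` alone generates `M`.
  let M := zpowers w ⊔ _root_.commutator G
  have hM : M.Normal := by
    refine ⟨fun n hn g => ?_⟩
    have h : ⁅g, n⁆ ∈ M := le_sup_right (a := zpowers w)
      (commutator_mem_commutator (mem_top g) (mem_top n))
    simpa [commutatorElement_def] using M.mul_mem h hn
  let F := (frattini M).map M.subtype
  have hF : F.Normal := inferInstance
  have hwM : w ∈ M := le_sup_left (b := _root_.commutator G) (mem_zpowers w)
  have hsqF : zpowers (w ^ 2) ≤ F := by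
    rw [zpowers_le]
    exact ⟨_, (hG.to_subgroup M).sq_mem_frattini ⟨w, hwM⟩, rfl⟩
  have hGF : _root_.commutator G ≤ F := by
    rw [← top_lowerCentralSeries_one]
    exact lowerCentralSeries_le_of_le_sup_succ (hw.trans (sup_le_sup_right hsqF _))
  have htop : zpowers (⟨w, hwM⟩ : M) ⊔ frattini M = ⊤ := by
    refine map_injective M.subtype_injective ?_
    rw [Subgroup.map_sup, MonoidHom.map_zpowers, ← MonoidHom.range_eq_map, range_subtype]
    refine le_antisymm (sup_le (zpowers_le.2 hwM) (map_subtype_le _)) (sup_le_sup_left hGF _)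
  refine ⟨w, le_sup_right.trans (?_ : M ≤ _)⟩
  have h := congrArg (Subgroup.map M.subtype) (frattini_nongenerating htop)
  rw [MonoidHom.map_zpowers, ← MonoidHom.range_eq_map, range_subtype] at h
  exact h.ge

/-- In a finite cyclic group, a subgroup `B` consists of all solutions of `g ^ |B| = 1`. -/
theorem le_of_card_dvd_of_isCyclic {C : Type*} [Group C] [Finite C] [IsCyclic C] {A B : Subgroup C}
    (h : Nat.card A ∣ Nat.card B) : A ≤ B := by
  classical
  have := Fintype.ofFinite C
  have hsub : (Finset.univ.filter (· ∈ B)) ⊆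
      Finset.univ.filter fun g : C => g ^ Nat.card B = 1 := fun g hg => by
    simp only [Finset.mem_filter, Finset.mem_univ, true_and] at hg ⊢
    exact orderOf_dvd_iff_pow_eq_one.1 (B.orderOf_dvd_natCard hg)
  have hcard : (Finset.univ.filter (· ∈ B)).card = Nat.card B := by
    rw [Nat.card_eq_fintype_card, Fintype.card_subtype]
  have heq := Finset.eq_of_subset_of_card_le hsub
    ((IsCyclic.card_pow_eq_one_le Nat.card_pos).trans hcard.ge)
  intro g hg
  obtain ⟨k, hk⟩ := h
  have hmem : g ∈ Finset.univ.filter fun g : C => g ^ Nat.card B = 1 := by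
    simp only [Finset.mem_filter, Finset.mem_univ, true_and]
    rw [hk, pow_mul, orderOf_dvd_iff_pow_eq_one.1 (A.orderOf_dvd_natCard hg), one_pow]
  rw [← heq] at hmem
  simpa using hmem

theorem IsPGroup.le_total_of_le_zpowers {p : ℕ} [Fact p.Prime] (hG : IsPGroup p G) {w : G}
    {A B : Subgroup G} (hA : A ≤ zpowers w) (hB : B ≤ zpowers w) : A ≤ B ∨ B ≤ A := by
  obtain ⟨a, ha⟩ := IsPGroup.iff_card.1 (hG.to_subgroup A)
  obtain ⟨b, hb⟩ := IsPGroup.iff_card.1 (hG.to_subgroup B)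
  have key : ∀ {A B : Subgroup G}, A ≤ zpowers w → B ≤ zpowers w → Nat.card A ∣ Nat.card B →
      A ≤ B := by
    intro A B hA hB h
    rw [← Nat.card_congr (subgroupOfEquivOfLe hA).toEquiv,
      ← Nat.card_congr (subgroupOfEquivOfLe hB).toEquiv] at h
    exact fun g hg => mem_subgroupOf.1
      (le_of_card_dvd_of_isCyclic h (mem_subgroupOf.2 hg : (⟨g, hA hg⟩ : zpowers w) ∈ _))
  rcases le_total a b with h | h
  · exact Or.inl (key hA hB (ha ▸ hb ▸ pow_dvd_pow p h))
  · exact Or.inr (key hB hA (ha ▸ hb ▸ pow_dvd_pow p h))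

end Taussky

/-! ### Nonvanishing of Tate cohomology -/

section Nonvanishing

variable {G : Type u} [Group G] [Finite G]

omit [Finite G] in
theorem exists_ne_one_mem_center_inf_commutator [Group.IsNilpotent G]
    (hne : commutator G ≠ ⊥) : ∃ z ∈ Subgroup.center G ⊓ commutator G, z ≠ 1 := by
  set c := Group.nilpotencyClass G with hc
  have hlt : 1 < c := by
    by_contra! hle
    rw [← Subgroup.lowerCentralSeries_eq_bot_iff_nilpotencyClass_le,
      Subgroup.top_lowerCentralSeries_one] at hle
    exact hne hle
  obtain ⟨d, hd⟩ : ∃ d, c = d + 1 := ⟨c - 1, by omega⟩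
  have hbot : (⊤ : Subgroup G).lowerCentralSeries (d + 1) = ⊥ :=
    Subgroup.lowerCentralSeries_eq_bot_iff_nilpotencyClass_le.2 (by omega)
  have hnebot : (⊤ : Subgroup G).lowerCentralSeries d ≠ ⊥ := fun h => by
    rw [Subgroup.lowerCentralSeries_eq_bot_iff_nilpotencyClass_le] at h
    omega
  obtain ⟨z, hz, hz1⟩ := (Subgroup.bot_or_exists_ne_one _).resolve_left hnebot
  refine ⟨z, ⟨Subgroup.commutator_top_right_eq_bot_iff_le_center.1 hbot hz, ?_⟩, hz1⟩
  rw [← Subgroup.top_lowerCentralSeries_one]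
  exact (⊤ : Subgroup G).lowerCentralSeries_antitone (by omega) hz

/-- If squaring is surjective on a subgroup of a finite `2`-group, then the subgroup is trivial. -/
theorem IsPGroup.eq_one_of_sq_surjOn (hG : IsPGroup 2 G) {P : Subgroup G}
    (hP : ∀ z ∈ P, ∃ b ∈ P, b ^ 2 = z) {z : G} (hz : z ∈ P) : z = 1 := by
  have key : ∀ k : ℕ, ∃ b ∈ P, b ^ 2 ^ k = z := fun k => by
    induction k with
    | zero => exact ⟨z, hz, by simp⟩
    | succ k ih =>
      obtain ⟨b, hb, hbz⟩ := ih
      obtain ⟨b', hb', rfl⟩ := hP b hb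
      exact ⟨b', hb', by rw [pow_succ', pow_mul, hbz]⟩
  have := Fact.mk Nat.prime_two
  obtain ⟨n, hn⟩ := IsPGroup.iff_card.1 hG
  obtain ⟨b, -, rfl⟩ := key n
  rw [← hn, pow_card_eq_one']

/-- The criterion for nonvanishing: `G'` is of index dividing eight, and the normal subgroups of `G`
inside `G'` form a chain. -/
theorem IsPGroup.nontrivial_frattiniTateH0 (hG : IsPGroup 2 G) (hna : ∃ a b : G, a * b ≠ b * a)
    (h8 : (commutator G).index ∣ 8)
    (hchain : ∀ A B : Subgroup G, A.Normal → B.Normal → A ≤ commutator G → B ≤ commutator G →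
      A ≤ B ∨ B ≤ A) : Nontrivial (frattiniTateH0 G) := by
  rw [← not_subsingleton_iff_nontrivial]
  intro hsub
  have := Fact.mk Nat.prime_two
  have := hG.isNilpotent
  have key : ∀ H₁ H₂ : Subgroup G, IsCoatom H₁ → IsCoatom H₂ → H₁ ≠ H₂ →
      centralizedPart H₁ ≤ centralizedPart H₂ → False := by
    intro H₁ H₂ hH₁ hH₂ hne hle
    have hsup : H₁ ⊔ H₂ = ⊤ := hH₁.sup_eq_top_of_ne hH₂ hne
    obtain ⟨z, hz, hz1⟩ := exists_ne_one_mem_center_inf_commutator (commutator_ne_bot hna)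
    refine hz1 (hG.eq_one_of_sq_surjOn (P := Subgroup.center G ⊓ frattini G) (fun z hz => ?_)
      ⟨hz.1, hG.commutator_le_frattini hz.2⟩)
    exact exists_sq_eq_of_centralizedPart_le_center hsub
      (fun x hx => hG.sq_mem_commutator_of_mem_frattini hna h8 hx)
      (hG.four_dvd_index_frattini hna) (hG.index_eq_two_of_isCoatom hH₁) (frattini_le_coatom hH₁)
      (centralizedPart_le_center hsup hle) hz
  obtain ⟨H₁, H₂, hH₁, hH₂, hne⟩ := exists_isCoatom_ne hna
  have := hG.normal_of_isCoatom hH₁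
  have := hG.normal_of_isCoatom hH₂
  rcases hchain (centralizedPart H₁) (centralizedPart H₂) inferInstance inferInstance inf_le_right
    inf_le_right with h | h
  · exact key H₁ H₂ hH₁ hH₂ hne h
  · exact key H₂ H₁ hH₂ hH₁ hne.symm h

end Nonvanishing

theorem mainTheorem9 (G : Type u) [Group G] [Finite G]
    (hG : IsPGroup 2 G) (hnonabelian : ∃ a b : G, a * b ≠ b * a) (hcoclass : HasCoclass 2 G 2) :
    IsSGroup G := by
  refine ⟨⟨2, Nat.prime_two, hG⟩, hnonabelian, ?_⟩
  have := Fact.mk Nat.prime_two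
  have := hG.isNilpotent
  obtain ⟨n, hn, hclass⟩ := hcoclass
  subst hclass
  rcases le_or_gt 8 (commutator G).index with h8 | h8
  · refine hG.nontrivial_frattiniTateH0 hnonabelian
      (index_commutator_eq_eight hn h8 (commutator_ne_bot hnonabelian)).dvd ?_
    intro A B _ _ hA hB
    obtain ⟨i, rfl⟩ := exists_eq_lowerCentralSeries hn h8 hA
    obtain ⟨j, rfl⟩ := exists_eq_lowerCentralSeries hn h8 hB
    rcases le_total i j with h | h
    · exact Or.inr ((⊤ : Subgroup G).lowerCentralSeries_antitone h)
    · exact Or.inl ((⊤ : Subgroup G).lowerCentralSeries_antitone h)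
  · -- Here `|G : G'| < 8`, and `4` divides `|G : Φ(G)|`, so `Φ(G) = G'` has index four.
    have hmul := Subgroup.relIndex_mul_index hG.commutator_le_frattini
    have hpos : (commutator G).index ≠ 0 := Subgroup.index_ne_zero_of_finite
    obtain ⟨k, hk⟩ := hG.four_dvd_index_frattini hnonabelian
    have hk1 : (commutator G).relIndex (frattini G) * k = 1 := by
      rw [hk] at hmul
      have : 4 * ((commutator G).relIndex (frattini G) * k) = (commutator G).index := by
        rw [← hmul]; ring
      omega
    obtain ⟨hrel, rfl⟩ := mul_eq_one.1 hk1
    have hΦ : frattini G = commutator G :=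
      le_antisymm (Subgroup.relIndex_eq_one.1 hrel) hG.commutator_le_frattini
    obtain ⟨w, hw⟩ := hG.exists_commutator_le_zpowers hnonabelian hk hΦ
    refine hG.nontrivial_frattiniTateH0 hnonabelian (hΦ ▸ hk ▸ by norm_num) ?_
    exact fun A B _ _ hA hB => hG.le_total_of_le_zpowers (hA.trans hw) (hB.trans hw)
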